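/- Let $N\ge 3$ be an integer, let $p_0,p_1,p_2,p_3\in[0,1]$, and put $q_m:=1-p_m$. Let $\Sigma:=\{0,1\}^N$, with coordinates of $x=(x_1,\dots,x_N)\in\Sigma$ indexed cyclically ($x_0:=x_N$, $x_{N+1}:=x_1$). For $x\in\Sigma$ and $1\le i\le N$ let $m_i(x):=2x_{i-1}+x_{i+1}\in\{0,1,2,3\}$, and let $x^i$ be $x$ with its $i$th coordinate replaced by $1-x_i$. Let $P$ be the transition matrix on $\Sigma$ with $$P(x,x^i)=\begin{cases}N^{-1}p_{m_i(x)}&\text{if }x_i=0,\\ N^{-1}q_{m_i(x)}&\text{if }x_i=1,\end{cases}\qquad P(x,x)=N^{-1}\Big(\sum_{i:x_i=0}q_{m_i(x)}+\sum_{i:x_i=1}p_{m_i(x)}\Big),$$ and $P(x,y)=0$ otherwise. Let $P^*$ be the transition matrix on $\Sigma^*:=\Sigma\times\{1,\dots,N\}$ with, for all $(x,i)\in\Sigma^*$ and $j=1,\dots,N$, $$P^*((x,i),(x^i,j))=\begin{cases}N^{-1}p_{m_i(x)}&\text{if }x_i=0,\\ N^{-1}q_{m_i(x)}&\text{if }x_i=1,\end{cases}\qquad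 P^*((x,i),(x,j))=\begin{cases}N^{-1}q_{m_i(x)}&\text{if }x_i=0,\\ N^{-1}p_{m_i(x)}&\text{if }x_i=1,\end{cases}$$ and all other entries $0$. Let the payoff $w((x,i),(y,j))$ be $1$ (a win) if $y=x^i$ and $x_i=0$, or $y=x$ and $x_i=1$ (entries $N^{-1}p_m$), and $-1$ (a loss) if $y=x^i$ and $x_i=1$, or $y=x$ and $x_i=0$ (entries $N^{-1}q_m$). Assume that the Markov chain with transition matrix $P$ is ergodic with unique stationary distribution $\pi$; that is, $\pi$ is the only stationary distribution of $P$, and for every initial distribution the distribution at time $n$ converges to $\pi$ as $n\to\infty$. Let $\pi_i$ and $\pi_{i,j}$ denote the one- and two-dimensional marginals of $\pi$. Then there is a real number $\mu^N$ such that, for every Markov chain $\{(X(n),I(n))\}_{n\ge0}$ in $\Sigma^*$ with transition matrix $P^*$ and arbitrary initial distribution, the cumulative profit $S_n:=\sum_{k=1}^n w\big((X(k-1),I(k-1)),(X(k),I(k))\big)$ satisfies $$n^{-1}S_n\to\mu^N\quad\text{almost surely.}$$ Moreover, $$\mu^N=\frac1N\sum_{x\in\Sigma}\pi(x)\sum_{i=1}^N\big[p_{m_i(x)}-q_{m_i(x)}\big];$$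 the marginals $\pi_{1,3}=\pi_{2,4}=\cdots=\pi_{N-1,1}=\pi_{N,2}$ all coincide and $$\mu^N=\sum_{u=0}^1\sum_{v=0}^1\pi_{1,3}(u,v)(p_{2u+v}-q_{2u+v})=2\big[\pi_{1,3}(0,0)p_0+\pi_{1,3}(0,1)p_1+\pi_{1,3}(1,0)p_2+\pi_{1,3}(1,1)p_3\big]-1;$$ and the marginals $\pi_1=\pi_2=\cdots=\pi_N$ all coincide and $$\mu^N=\pi_1(1)-\pi_1(0)=2\pi_1(1)-1.$$ -/

import Mathlib

open MeasureTheory Filter Topology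

namespace Parrondo

noncomputable section

/-! ### Finite Markov chains in discrete time -/

section MarkovChain

variable {S : Type*} [Fintype S] [DecidableEq S]

/-- `π` is a stationary distribution of the one-step transition matrix `P`. -/
def IsStationary (P : Matrix S S ℝ) (π : S → ℝ) : Prop :=
  π ∈ stdSimplex ℝ S ∧ Matrix.vecMul π P = π

/-- The chain with one-step transition matrix `P` is ergodic with unique stationary
distribution `π`: there is exactly one stationary distribution, namely `π`, and the distribution
at time `n` converges to it as `n → ∞`, whatever the initial distribution `ν`. -/
structure IsErgodicWith (P : Matrix S S ℝ) (π : S → ℝ) : Prop where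
  stationary : IsStationary P π
  unique : ∀ π' : S → ℝ, IsStationary P π' → π' = π
  tendsto : ∀ ν ∈ stdSimplex ℝ S, Tendsto (fun n : ℕ => Matrix.vecMul ν (P ^ n)) atTop (𝓝 π)

end MarkovChain

/-- `Z 0, Z 1, …` is a (time-homogeneous) Markov chain on the probability space `(Ω, ℙ)` with one-step
transition matrix `P`. The law of `Z 0` is arbitrary. The state space is meant to be finite or
countable, so that `measurable` says that each `Z n` is a random variable; `markov` is
`ℙ(Z (n+1) = s (n+1) | Z 0 = s 0, …, Z n = s n) = P (s n) (s (n+1))`, multiplied by the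
probability of the condition. -/
structure IsMarkovChain {S Ω : Type*} [MeasurableSpace Ω] (P : Matrix S S ℝ) (ℙ : Measure Ω)
    (Z : ℕ → Ω → S) : Prop where
  measurable : ∀ (n : ℕ) (s : S), MeasurableSet {ω | Z n ω = s}
  markov : ∀ (n : ℕ) (s : ℕ → S),
    ℙ.real {ω | ∀ k ≤ n + 1, Z k ω = s k} =
      ℙ.real {ω | ∀ k ≤ n, Z k ω = s k} * P (s n) (s (n + 1))

/-! ### The `N`-player game

Players are labelled by `ZMod N`, that is `1, …, N` modulo `N`, so that the cyclic conventions
`x₀ = x_N` and `x_{N+1} = x₁` hold automatically. -/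

/-- Status of every player: `0` for a loser, `1` for a winner. -/
abbrev Config (N : ℕ) : Type := ZMod N → Fin 2

/-- The number `2u + v ∈ {0, 1, 2, 3}`. -/
def code (u v : Fin 2) : Fin 4 := ⟨2 * u.val + v.val, by omega⟩

variable {N : ℕ}

/-- `m_i(x) = 2 x_{i-1} + x_{i+1}`. -/
def nbr (x : Config N) (i : ZMod N) : Fin 4 := code (x (i - 1)) (x (i + 1))

/-- `x^i`, the configuration `x` with the `i`-th component flipped. -/
def flipAt (x : Config N) (i : ZMod N) : Config N := Function.update x i (1 - x i)

/-- Probability that player `i`, when playing in configuration `x`, changes status. -/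
def flipProb (p : Fin 4 → ℝ) (x : Config N) (i : ZMod N) : ℝ :=
  if x i = 0 then p (nbr x i) else 1 - p (nbr x i)

/-- Probability that player `i`, when playing in configuration `x`, keeps status. -/
def stayProb (p : Fin 4 → ℝ) (x : Config N) (i : ZMod N) : ℝ :=
  if x i = 0 then 1 - p (nbr x i) else p (nbr x i)

/-- The one-step transition matrix `P` on configurations. (The configurations `x^i` are pairwise
distinct, so at most one term of the second sum is nonzero.) -/
def transition [NeZero N] (p : Fin 4 → ℝ) : Matrix (Config N) (Config N) ℝ := fun x y =>
  if y = x then (N : ℝ)⁻¹ * ∑ i : ZMod N, stayProb p x i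
  else ∑ i : ZMod N, if y = flipAt x i then (N : ℝ)⁻¹ * flipProb p x i else 0

/-- The augmented state `(x, i)`: configuration and next player to play. -/
abbrev AugState (N : ℕ) : Type := Config N × ZMod N

/-- The one-step transition matrix `P*` on augmented states. -/
def augTransition [NeZero N] (p : Fin 4 → ℝ) : Matrix (AugState N) (AugState N) ℝ := fun s t =>
  if t.1 = flipAt s.1 s.2 then (N : ℝ)⁻¹ * flipProb p s.1 s.2
  else if t.1 = s.1 then (N : ℝ)⁻¹ * stayProb p s.1 s.2
  else 0

/-- The payoff: `1` if the entry of `P*` is of the form `N⁻¹ p_m` (a win) and `-1` if it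
is of the form `N⁻¹ q_m` (a loss); `0` for the transitions that `P*` excludes. -/
def payoff [NeZero N] (s t : AugState N) : ℝ :=
  if t.1 = flipAt s.1 s.2 then (if s.1 s.2 = 0 then 1 else -1)
  else if t.1 = s.1 then (if s.1 s.2 = 0 then -1 else 1)
  else 0

/-- The ensemble's cumulative profit `S_n = ξ₁ + ⋯ + ξ_n`, with `ξ_{k+1} = w(Z_k, Z_{k+1})`. -/
def profit [NeZero N] {Ω : Type*} (Z : ℕ → Ω → AugState N) (n : ℕ) (ω : Ω) : ℝ :=
  ∑ k ∈ Finset.range n, payoff (Z k ω) (Z (k + 1) ω)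

/-- The one-dimensional marginal `π_i(u)`. -/
def marginal₁ [NeZero N] (π : Config N → ℝ) (i : ZMod N) (u : Fin 2) : ℝ :=
  ∑ x : Config N with x i = u, π x

/-- The two-dimensional marginal `π_{i,j}(u,v)`. -/
def marginal₂ [NeZero N] (π : Config N → ℝ) (i j : ZMod N) (u v : Fin 2) : ℝ :=
  ∑ x : Config N with x i = u ∧ x j = v, π x

end

end Parrondo

namespace Parrondo

/-! ### A strong law of large numbers for functionals of a finite Markov chain -/

section StrongLaw

variable {S Ω : Type*} {Z : ℕ → Ω → S}

/-- The trajectory of `Z` up to time `n`. -/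
def history (Z : ℕ → Ω → S) (n : ℕ) (ω : Ω) : Fin (n + 1) → S := fun k => Z k ω

/-- The sum of the values of `F` along the first `n` transitions. -/
def pathSum (Z : ℕ → Ω → S) (F : S → S → ℝ) (n : ℕ) (ω : Ω) : ℝ :=
  ∑ k ∈ Finset.range n, F (Z k ω) (Z (k + 1) ω)

theorem pathSum_succ (F : S → S → ℝ) (n : ℕ) (ω : Ω) :
    pathSum Z F (n + 1) ω = pathSum Z F n ω + F (Z n ω) (Z (n + 1) ω) :=
  Finset.sum_range_succ _ _

/-- The partial sums as a function of the trajectory. -/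
theorem pathSum_eq_history (F : S → S → ℝ) (n : ℕ) :
    ∃ G : (Fin (n + 1) → S) → ℝ, ∀ ω, pathSum Z F n ω = G (history Z n ω) := by
  refine ⟨fun s => ∑ k : Fin n, F (s k.castSucc) (s k.succ), fun ω => ?_⟩
  simp [pathSum, history, Finset.sum_range]

variable [MeasurableSpace Ω] {Q : Matrix S S ℝ} {ℙ : Measure Ω}

theorem integrable_comp_of_finite [IsFiniteMeasure ℙ] {T : Type*} [Finite T] {Y : Ω → T}
    (hY : ∀ t, MeasurableSet {ω | Y ω = t}) (φ : T → ℝ) : Integrable (fun ω => φ (Y ω)) ℙ := by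
  let _ : MeasurableSpace T := ⊤
  have : Countable T := Finite.to_countable
  have hm : Measurable Y := measurable_to_countable' hY
  exact (Integrable.of_finite (μ := ℙ.map Y) (f := φ)).comp_measurable hm

theorem integral_comp_of_fintype [IsFiniteMeasure ℙ] {T : Type*} [Fintype T] {Y : Ω → T}
    (hY : ∀ t, MeasurableSet {ω | Y ω = t}) (φ : T → ℝ) :
    ∫ ω, φ (Y ω) ∂ℙ = ∑ t, ℙ.real {ω | Y ω = t} * φ t := by
  let _ : MeasurableSpace T := ⊤
  have hm : Measurable Y := measurable_to_countable' hY
  rw [← integral_map hm.aemeasurable (Measurable.of_discrete (f := φ)).aestronglyMeasurable,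
    integral_fintype Integrable.of_finite]
  refine Finset.sum_congr rfl fun t _ => ?_
  rw [map_measureReal_apply hm (measurableSet_singleton t), smul_eq_mul]
  rfl

theorem IsMarkovChain.measurableSet_history (hZ : IsMarkovChain Q ℙ Z) (n : ℕ)
    (s : Fin (n + 1) → S) : MeasurableSet {ω | history Z n ω = s} := by
  have : {ω | history Z n ω = s} = ⋂ k : Fin (n + 1), {ω | Z k ω = s k} := by
    ext ω; simp [history, funext_iff]
  rw [this]
  exact MeasurableSet.iInter fun k => hZ.measurable _ _

theorem IsMarkovChain.measurableSet_history_prod (hZ : IsMarkovChain Q ℙ Z) (n : ℕ)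
    (s : (Fin (n + 1) → S) × S) :
    MeasurableSet {ω | (history Z n ω, Z (n + 1) ω) = s} := by
  have : {ω | (history Z n ω, Z (n + 1) ω) = s}
      = {ω | history Z n ω = s.1} ∩ {ω | Z (n + 1) ω = s.2} := by
    ext ω; simp [Prod.ext_iff]
  rw [this]
  exact (hZ.measurableSet_history n _).inter (hZ.measurable _ _)

theorem IsMarkovChain.measureReal_history_prod (hZ : IsMarkovChain Q ℙ Z) (n : ℕ)
    (s : Fin (n + 1) → S) (t : S) :
    ℙ.real {ω | (history Z n ω, Z (n + 1) ω) = (s, t)} =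
      ℙ.real {ω | history Z n ω = s} * Q (s (Fin.last n)) t := by
  have h := hZ.markov n (fun k => if hk : k < n + 1 then s ⟨k, hk⟩ else t)
  have h₁ : {ω | ∀ k ≤ n, Z k ω = if hk : k < n + 1 then s ⟨k, hk⟩ else t}
      = {ω | history Z n ω = s} := by
    ext ω
    simp only [Set.mem_ofPred_eq, history, funext_iff]
    constructor
    · intro h k
      simpa [k.is_le] using h k k.is_le
    · intro h k hk
      rw [dif_pos (Nat.lt_succ_of_le hk)]
      exact h ⟨k, Nat.lt_succ_of_le hk⟩
  have h₂ : {ω | ∀ k ≤ n + 1, Z k ω = if hk : k < n + 1 then s ⟨k, hk⟩ else t}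
      = {ω | (history Z n ω, Z (n + 1) ω) = (s, t)} := by
    ext ω
    simp only [Set.mem_ofPred_eq, history, funext_iff, Prod.mk.injEq]
    constructor
    · intro h
      exact ⟨fun k => by simpa [k.is_le] using h k k.2.le, by simpa using h (n + 1) le_rfl⟩
    · rintro ⟨h, h'⟩ k hk
      split_ifs with hk'
      · exact h ⟨k, hk'⟩
      · obtain rfl : k = n + 1 := by omega
        exact h'
  rw [h₁, h₂] at h
  simpa [Fin.last] using h

variable [Fintype S]

/-- A function of one transition with zero conditional mean is orthogonal to the past. -/
theorem IsMarkovChain.integral_history_mul_eq_zero [IsFiniteMeasure ℙ]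
    (hZ : IsMarkovChain Q ℙ Z) {F : S → S → ℝ} (hF : ∀ s, ∑ t, Q s t * F s t = 0) (n : ℕ)
    (G : (Fin (n + 1) → S) → ℝ) :
    ∫ ω, G (history Z n ω) * F (Z n ω) (Z (n + 1) ω) ∂ℙ = 0 := by
  classical
  have h := integral_comp_of_fintype (ℙ := ℙ) (hZ.measurableSet_history_prod n)
    (fun s => G s.1 * F (s.1 (Fin.last n)) s.2)
  have h' : ∀ ω, history Z n ω (Fin.last n) = Z n ω := fun ω => rfl
  simp only [h'] at h
  rw [h, Fintype.sum_prod_type]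
  refine Finset.sum_eq_zero fun s _ => ?_
  have h₀ := hF (s (Fin.last n))
  calc _ = ∑ t, ℙ.real {ω | history Z n ω = s} * G s *
        (Q (s (Fin.last n)) t * F (s (Fin.last n)) t) := by
        refine Finset.sum_congr rfl fun t _ => ?_
        rw [hZ.measureReal_history_prod]
        ring
    _ = 0 := by rw [← Finset.mul_sum, h₀, mul_zero]

theorem IsMarkovChain.integrable_sq_pathSum [IsFiniteMeasure ℙ] (hZ : IsMarkovChain Q ℙ Z)
    (F : S → S → ℝ) (n : ℕ) : Integrable (fun ω => pathSum Z F n ω ^ 2) ℙ := by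
  obtain ⟨G, hG⟩ := pathSum_eq_history (Z := Z) F n
  simp only [hG]
  exact integrable_comp_of_finite (hZ.measurableSet_history n) (fun s => G s ^ 2)

theorem IsMarkovChain.integral_sq_pathSum_le [IsProbabilityMeasure ℙ]
    (hZ : IsMarkovChain Q ℙ Z) {F : S → S → ℝ} (hF : ∀ s, ∑ t, Q s t * F s t = 0) {B : ℝ}
    (hB : ∀ s t, |F s t| ≤ B) (n : ℕ) :
    ∫ ω, pathSum Z F n ω ^ 2 ∂ℙ ≤ B ^ 2 * n := by
  induction n with
  | zero => simp [pathSum]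
  | succ n ih =>
    obtain ⟨G, hG⟩ := pathSum_eq_history (Z := Z) F n
    have hcross := hZ.integral_history_mul_eq_zero hF n G
    simp only [← hG] at hcross
    have i₁ := hZ.integrable_sq_pathSum F n
    have i₂ : Integrable (fun ω => pathSum Z F n ω * F (Z n ω) (Z (n + 1) ω)) ℙ := by
      simp only [hG]
      exact integrable_comp_of_finite (hZ.measurableSet_history_prod n)
        (fun s => G s.1 * F (s.1 (Fin.last n)) s.2)
    have i₃ : Integrable (fun ω => F (Z n ω) (Z (n + 1) ω) ^ 2) ℙ :=
      integrable_comp_of_finite (hZ.measurableSet_history_prod n)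
        (fun s => F (s.1 (Fin.last n)) s.2 ^ 2)
    have hsq : ∫ ω, F (Z n ω) (Z (n + 1) ω) ^ 2 ∂ℙ ≤ B ^ 2 := by
      calc _ ≤ ∫ _, B ^ 2 ∂ℙ :=
            integral_mono i₃ (integrable_const _) fun ω => sq_le_sq' (abs_le.1 (hB _ _)).1
              (abs_le.1 (hB _ _)).2
        _ = B ^ 2 := by simp
    have e : ∀ ω, pathSum Z F (n + 1) ω ^ 2 = pathSum Z F n ω ^ 2 +
        2 * (pathSum Z F n ω * F (Z n ω) (Z (n + 1) ω)) + F (Z n ω) (Z (n + 1) ω) ^ 2 := by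
      intro ω
      rw [pathSum_succ]
      ring
    simp only [e]
    have i₁₂ : Integrable (fun ω => pathSum Z F n ω ^ 2 +
        2 * (pathSum Z F n ω * F (Z n ω) (Z (n + 1) ω))) ℙ := i₁.add (i₂.const_mul 2)
    rw [integral_add i₁₂ i₃, integral_add i₁ (i₂.const_mul 2),
      integral_const_mul, hcross]
    push_cast
    linarith

/-- Along the squares, the averages of centred transition functionals converge to zero. -/
theorem IsMarkovChain.ae_tendsto_pathSum_sq [IsProbabilityMeasure ℙ]
    (hZ : IsMarkovChain Q ℙ Z) {F : S → S → ℝ} (hF : ∀ s, ∑ t, Q s t * F s t = 0) {B : ℝ}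
    (hB : ∀ s t, |F s t| ≤ B) :
    ∀ᵐ ω ∂ℙ, Tendsto (fun n : ℕ => pathSum Z F ((n + 1) ^ 2) ω / (((n + 1) ^ 2 : ℕ) : ℝ))
      atTop (𝓝 0) := by
  set a : ℕ → Ω → ℝ := fun n ω => (pathSum Z F ((n + 1) ^ 2) ω / (((n + 1) ^ 2 : ℕ) : ℝ)) ^ 2
    with ha
  have hint : ∀ n, Integrable (a n) ℙ := fun n => by
    simp only [ha, div_pow]
    exact (hZ.integrable_sq_pathSum F _).div_const _
  have hle : ∀ n, ∫ ω, a n ω ∂ℙ ≤ B ^ 2 * (1 / ((n : ℝ) + 1) ^ 2) := fun n => by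
    simp only [ha, div_pow]
    rw [integral_div]
    have h := hZ.integral_sq_pathSum_le hF hB ((n + 1) ^ 2)
    have hn : (0 : ℝ) < (n : ℝ) + 1 := by positivity
    push_cast at h ⊢
    rw [div_le_iff₀ (by positivity)]
    refine h.trans_eq ?_
    field_simp
  have hsum : Summable fun n : ℕ => B ^ 2 * (1 / ((n : ℝ) + 1) ^ 2) := by
    have h := (summable_nat_add_iff 1).2 (Real.summable_one_div_nat_pow.2 one_lt_two)
    push_cast at h
    exact h.mul_left _
  have hfin : ∫⁻ ω, ∑' n, ENNReal.ofReal (a n ω) ∂ℙ ≠ ⊤ := by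
    rw [lintegral_tsum fun n => (hint n).aestronglyMeasurable.aemeasurable.ennreal_ofReal]
    refine ne_top_of_le_ne_top hsum.tsum_ofReal_ne_top (ENNReal.tsum_le_tsum fun n => ?_)
    rw [← ofReal_integral_eq_lintegral_ofReal (hint n) (ae_of_all _ fun ω => sq_nonneg _)]
    exact ENNReal.ofReal_le_ofReal (hle n)
  have hmeas : AEMeasurable (fun ω => ∑' n, ENNReal.ofReal (a n ω)) ℙ :=
    AEMeasurable.tsum fun n => (hint n).aestronglyMeasurable.aemeasurable.ennreal_ofReal
  filter_upwards [ae_lt_top' hmeas hfin] with ω hω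
  have h := ENNReal.tendsto_atTop_zero_of_tsum_ne_top hω.ne
  have h₀ : Tendsto (fun n => a n ω) atTop (𝓝 0) := by
    have h' := (ENNReal.tendsto_toReal ENNReal.zero_ne_top).comp h
    refine h'.congr fun n => ?_
    simp [ENNReal.toReal_ofReal, ha, sq_nonneg]
  have h₁ := h₀.sqrt
  simp only [ha, Real.sqrt_sq_eq_abs, Real.sqrt_zero] at h₁
  exact (tendsto_zero_iff_abs_tendsto_zero _).2 h₁

/-- Strong law of large numbers for centred transition functionals of a finite Markov chain. -/
theorem IsMarkovChain.ae_tendsto_pathSum [IsProbabilityMeasure ℙ]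
    (hZ : IsMarkovChain Q ℙ Z) {F : S → S → ℝ} (hF : ∀ s, ∑ t, Q s t * F s t = 0) :
    ∀ᵐ ω ∂ℙ, Tendsto (fun n : ℕ => pathSum Z F n ω / n) atTop (𝓝 0) := by
  obtain ⟨B, hB⟩ : ∃ B : ℝ, ∀ s t, |F s t| ≤ B := by
    refine ⟨∑ s, ∑ t, |F s t|, fun s t => ?_⟩
    exact (Finset.single_le_sum (f := fun t => |F s t|) (fun _ _ => abs_nonneg _)
      (Finset.mem_univ t)).trans (Finset.single_le_sum (f := fun s => ∑ t, |F s t|)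
      (fun _ _ => Finset.sum_nonneg fun _ _ => abs_nonneg _) (Finset.mem_univ s))
  filter_upwards [hZ.ae_tendsto_pathSum_sq hF hB] with ω hω
  have hmono : Monotone fun n : ℕ => pathSum Z F n ω + B * n := by
    refine monotone_nat_of_le_succ fun n => ?_
    have := (abs_le.1 (hB (Z n ω) (Z (n + 1) ω))).1
    rw [pathSum_succ]
    push_cast
    linarith
  have key : Tendsto (fun n : ℕ => (pathSum Z F n ω + B * n) / n) atTop (𝓝 B) := by
    refine tendsto_div_of_monotone_of_exists_subseq_tendsto_div _ _ hmono fun a ha => ?_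
    refine ⟨fun n => (n + 1) ^ 2, ?_, ?_, ?_⟩
    · have h : Tendsto (fun n : ℕ => (1 + 1 / ((n : ℝ) + 1)) ^ 2) atTop (𝓝 1) := by
        simpa using (tendsto_one_div_add_atTop_nhds_zero_nat (𝕜 := ℝ).const_add 1).pow 2
      filter_upwards [h.eventually_le_const ha] with n hn
      have hn₀ : (0 : ℝ) < (n : ℝ) + 1 := by positivity
      push_cast
      calc ((n : ℝ) + 1 + 1) ^ 2 = (1 + 1 / ((n : ℝ) + 1)) ^ 2 * (n + 1) ^ 2 := by
            field_simp
        _ ≤ _ := by gcongr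
    · exact (tendsto_pow_atTop two_ne_zero).comp (tendsto_add_atTop_nat 1)
    · have h := hω.add_const B
      rw [zero_add] at h
      refine h.congr fun n => ?_
      have : (((n + 1) ^ 2 : ℕ) : ℝ) ≠ 0 := by positivity
      field_simp
  have h := key.sub_const B
  rw [sub_self] at h
  refine h.congr' ?_
  filter_upwards [eventually_gt_atTop 0] with n hn
  have : (n : ℝ) ≠ 0 := by positivity
  field_simp
  ring

/-- If `g` is the conditional mean of the transition functional `w` and `h` solves the Poisson
equation `h - Q h = g - μ`, then the averages of `w` converge to `μ`. -/
theorem IsMarkovChain.ae_tendsto_of_poisson [IsProbabilityMeasure ℙ]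
    (hZ : IsMarkovChain Q ℙ Z) (hQ : ∀ s, ∑ t, Q s t = 1) {w : S → S → ℝ} {h : S → ℝ} {μ : ℝ}
    (hh : ∀ s, h s - ∑ t, Q s t * h t = ∑ t, Q s t * w s t - μ) :
    ∀ᵐ ω ∂ℙ, Tendsto (fun n : ℕ => (n : ℝ)⁻¹ * pathSum Z w n ω) atTop (𝓝 μ) := by
  have hF : ∀ s, ∑ t, Q s t * (w s t - μ + h t - h s) = 0 := fun s => by
    have e : ∀ t, Q s t * (w s t - μ + h t - h s)
        = Q s t * w s t + Q s t * h t - Q s t * (μ + h s) := fun t => by ring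
    simp only [e]
    rw [Finset.sum_sub_distrib, Finset.sum_add_distrib, ← Finset.sum_mul, hQ]
    linarith [hh s]
  filter_upwards [hZ.ae_tendsto_pathSum hF] with ω hω
  have hsum : ∀ n : ℕ, pathSum Z (fun s t => w s t - μ + h t - h s) n ω
      = pathSum Z w n ω - n * μ + h (Z n ω) - h (Z 0 ω) := by
    intro n
    induction n with
    | zero => simp [pathSum]
    | succ n ih =>
      rw [pathSum_succ, ih, pathSum_succ]
      push_cast
      ring
  have hbdd : Tendsto (fun n : ℕ => (h (Z n ω) - h (Z 0 ω)) / (n : ℝ)) atTop (𝓝 0) := by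
    obtain ⟨C, hC⟩ : ∃ C : ℝ, ∀ s, |h s| ≤ C :=
      ⟨∑ s, |h s|, fun s => Finset.single_le_sum (f := fun s => |h s|)
        (fun _ _ => abs_nonneg _) (Finset.mem_univ s)⟩
    refine squeeze_zero_norm (fun n => ?_) (tendsto_const_div_atTop_nhds_zero_nat (2 * C))
    rw [norm_div, Real.norm_eq_abs, Real.norm_natCast]
    gcongr
    exact (abs_sub _ _).trans (by linarith [hC (Z n ω), hC (Z 0 ω)])
  have hlim := (hω.sub hbdd).add_const μ
  rw [sub_zero, zero_add] at hlim
  refine hlim.congr' ?_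
  filter_upwards [eventually_gt_atTop 0] with n hn
  have : (n : ℝ) ≠ 0 := by positivity
  rw [hsum]
  field_simp
  ring

end StrongLaw

/-! ### The Poisson equation of an ergodic chain -/

section Poisson

open Matrix

variable {S : Type*} [Fintype S] [DecidableEq S] {P : Matrix S S ℝ} {π : S → ℝ}

theorem IsErgodicWith.dotProduct_one (h : IsErgodicWith P π) : π ⬝ᵥ 1 = 1 := by
  simpa [dotProduct] using h.stationary.1.2

theorem IsErgodicWith.dotProduct_mulVec (h : IsErgodicWith P π) (φ : S → ℝ) :
    π ⬝ᵥ (P *ᵥ φ) = π ⬝ᵥ φ := by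
  rw [Matrix.dotProduct_mulVec, h.stationary.2]

/-- Harmonic functions of an ergodic chain are constant. -/
theorem IsErgodicWith.eq_const_of_mulVec_eq (h : IsErgodicWith P π) {φ : S → ℝ}
    (hφ : P *ᵥ φ = φ) (s : S) : φ s = π ⬝ᵥ φ := by
  have hpow : ∀ n : ℕ, P ^ n *ᵥ φ = φ := fun n => by
    induction n with
    | zero => simp
    | succ n ih => rw [pow_succ, ← mulVec_mulVec, hφ, ih]
  have hlim := h.tendsto (Pi.single s 1) (single_mem_stdSimplex ℝ s)
  have hc : Continuous fun v : S → ℝ => v ⬝ᵥ φ := by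
    unfold dotProduct
    fun_prop
  refine tendsto_nhds_unique ?_ ((hc.tendsto π).comp hlim)
  refine tendsto_const_nhds.congr fun n => ?_
  rw [Function.comp_apply, ← Matrix.dotProduct_mulVec, hpow, single_one_dotProduct]

theorem IsErgodicWith.exists_poisson (h : IsErgodicWith P π) {f : S → ℝ} (hf : π ⬝ᵥ f = 0) :
    ∃ φ : S → ℝ, φ - P *ᵥ φ = f := by
  let L : (S → ℝ) →ₗ[ℝ] (S → ℝ) :=
    { toFun := fun φ => φ - P *ᵥ φ + (π ⬝ᵥ φ) • 1
      map_add' := fun φ ψ => by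
        rw [mulVec_add, dotProduct_add, add_smul]
        abel
      map_smul' := fun c φ => by
        rw [mulVec_smul, dotProduct_smul, RingHom.id_apply, smul_add, smul_sub, smul_assoc] }
  have hL : ∀ φ, π ⬝ᵥ L φ = π ⬝ᵥ φ := fun φ => by
    change π ⬝ᵥ (φ - P *ᵥ φ + (π ⬝ᵥ φ) • 1) = _
    rw [dotProduct_add, dotProduct_sub, h.dotProduct_mulVec, dotProduct_smul,
      h.dotProduct_one]
    simp
  have hmean : ∀ φ, π ⬝ᵥ L φ = 0 → φ - P *ᵥ φ = L φ := fun φ h₀ => by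
    rw [hL] at h₀
    change _ = φ - P *ᵥ φ + (π ⬝ᵥ φ) • 1
    rw [h₀, zero_smul, add_zero]
  have hinj : Function.Injective L := by
    rw [injective_iff_map_eq_zero]
    intro φ hφ
    have h₀ : π ⬝ᵥ L φ = 0 := by rw [hφ, dotProduct_zero]
    have h₁ := hmean φ h₀
    rw [hφ, sub_eq_zero] at h₁
    funext s
    rw [h.eq_const_of_mulVec_eq h₁.symm s, ← hL, h₀, Pi.zero_apply]
  obtain ⟨φ, rfl⟩ := LinearMap.injective_iff_surjective.1 hinj f
  exact ⟨φ, hmean φ hf⟩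

end Poisson

/-! ### The game -/

section Game

variable {N : ℕ}

theorem flipAt_ne (x : Config N) (i : ZMod N) : flipAt x i ≠ x := by
  intro h
  have h₁ := congrFun h i
  simp only [flipAt, Function.update_self] at h₁
  generalize x i = u at h₁
  revert u
  decide

theorem flipProb_add_stayProb (p : Fin 4 → ℝ) (x : Config N) (i : ZMod N) :
    flipProb p x i + stayProb p x i = 1 := by
  unfold flipProb stayProb
  split_ifs <;> ring

/-- Rotation of a configuration by `c`. -/
def rotate (c : ZMod N) : Config N ≃ Config N :=
  (Equiv.addRight (-c)).arrowCongr (Equiv.refl (Fin 2))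

theorem rotate_apply (c : ZMod N) (x : Config N) (i : ZMod N) : rotate c x i = x (i + c) := by
  simp [rotate]

theorem nbr_rotate (c : ZMod N) (x : Config N) (i : ZMod N) :
    nbr (rotate c x) i = nbr x (i + c) := by
  simp only [nbr, rotate_apply]
  congr 2 <;> ring

theorem flipAt_rotate (c : ZMod N) (x : Config N) (i : ZMod N) :
    flipAt (rotate c x) i = rotate c (flipAt x (i + c)) := by
  funext j
  simp only [flipAt, rotate_apply, Function.update_apply, add_left_inj]

variable [NeZero N]

theorem natCast_inv_mul_sum_const (c : ℝ) : (N : ℝ)⁻¹ * ∑ _ : ZMod N, c = c := by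
  have : (N : ℝ) ≠ 0 := NeZero.ne _
  rw [Finset.sum_const, Finset.card_univ, ZMod.card, nsmul_eq_mul, inv_mul_cancel_left₀ this]

theorem sum_transition_mul (p : Fin 4 → ℝ) (φ : Config N → ℝ) (x : Config N) :
    ∑ y, transition p x y * φ y =
      (N : ℝ)⁻¹ * ∑ i, (flipProb p x i * φ (flipAt x i) + stayProb p x i * φ x) := by
  have e : ∀ y, transition p x y * φ y =
      (if y = x then ((N : ℝ)⁻¹ * ∑ i : ZMod N, stayProb p x i) * φ x else 0) +
      ∑ i : ZMod N, if y = flipAt x i then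
        (N : ℝ)⁻¹ * (flipProb p x i * φ (flipAt x i)) else 0 := by
    intro y
    unfold transition
    split_ifs with hy
    · subst hy
      simp [(flipAt_ne _ _).symm]
    · rw [zero_add, Finset.sum_mul]
      refine Finset.sum_congr rfl fun i _ => ?_
      split_ifs with hi
      · rw [← hi, mul_assoc]
      · rw [zero_mul]
  simp only [e]
  rw [Finset.sum_add_distrib, Finset.sum_comm]
  simp only [Finset.sum_ite_eq', Finset.mem_univ, if_true]
  rw [Finset.sum_add_distrib, ← Finset.sum_mul, ← Finset.mul_sum]
  ring

theorem sum_augTransition_mul (p : Fin 4 → ℝ) (F : AugState N → ℝ) (s : AugState N) :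
    ∑ t, augTransition p s t * F t =
      flipProb p s.1 s.2 * ((N : ℝ)⁻¹ * ∑ j, F (flipAt s.1 s.2, j)) +
      stayProb p s.1 s.2 * ((N : ℝ)⁻¹ * ∑ j, F (s.1, j)) := by
  have e : ∀ (y : Config N) (j : ZMod N), augTransition p s (y, j) * F (y, j) =
      (if y = flipAt s.1 s.2 then
        flipProb p s.1 s.2 * ((N : ℝ)⁻¹ * F (flipAt s.1 s.2, j)) else 0) +
      (if y = s.1 then stayProb p s.1 s.2 * ((N : ℝ)⁻¹ * F (s.1, j)) else 0) := by
    intro y j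
    unfold augTransition
    by_cases h₁ : y = flipAt s.1 s.2
    · subst h₁
      simp only [if_true, flipAt_ne, if_false]
      ring
    · by_cases h₂ : y = s.1
      · subst h₂
        simp only [h₁, if_true, if_false]
        ring
      · simp [h₁, h₂]
  rw [Fintype.sum_prod_type_right]
  simp only [e, Finset.sum_add_distrib, Finset.sum_ite_eq', Finset.mem_univ, if_true,
    ← Finset.mul_sum]

theorem sum_augTransition (p : Fin 4 → ℝ) (s : AugState N) :
    ∑ t, augTransition p s t = 1 := by
  have h := sum_augTransition_mul p (fun _ => 1) s
  simp only [mul_one, natCast_inv_mul_sum_const, flipProb_add_stayProb] at h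
  exact h

theorem sum_augTransition_mul_payoff (p : Fin 4 → ℝ) (s : AugState N) :
    ∑ t, augTransition p s t * payoff s t =
      p (nbr s.1 s.2) - (1 - p (nbr s.1 s.2)) := by
  rw [sum_augTransition_mul]
  simp only [payoff, if_true, (flipAt_ne _ _).symm, if_false, natCast_inv_mul_sum_const]
  unfold flipProb stayProb
  split_ifs <;> ring

/-- A solution of the Poisson equation on configurations lifts to augmented states. -/
theorem augTransition_poisson {p : Fin 4 → ℝ} {φ : Config N → ℝ} {G : AugState N → ℝ}
    (hφ : ∀ x, φ x - ∑ y, transition p x y * φ y = (N : ℝ)⁻¹ * ∑ i, G (x, i)) (s : AugState N) :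
    let h : AugState N → ℝ := fun s =>
      G s + (flipProb p s.1 s.2 * φ (flipAt s.1 s.2) + stayProb p s.1 s.2 * φ s.1)
    h s - ∑ t, augTransition p s t * h t = G s := by
  intro h
  have hA : ∀ x, (N : ℝ)⁻¹ * ∑ j, h (x, j) = φ x := fun x => by
    have := hφ x
    rw [sum_transition_mul] at this
    simp only [h]
    rw [Finset.sum_add_distrib, mul_add]
    linarith
  rw [sum_augTransition_mul, hA, hA]
  simp only [h]
  ring

/-! ### Rotation invariance of the stationary distribution, and its marginals -/

theorem transition_rotate (p : Fin 4 → ℝ) (c : ZMod N) (x y : Config N) :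
    transition p (rotate c x) (rotate c y) = transition p x y := by
  have hs : ∀ i, stayProb p (rotate c x) i = stayProb p x (i + c) := fun i => by
    simp only [stayProb, rotate_apply, nbr_rotate]
  have hf : ∀ i, flipProb p (rotate c x) i = flipProb p x (i + c) := fun i => by
    simp only [flipProb, rotate_apply, nbr_rotate]
  simp only [transition, hs, hf, flipAt_rotate, EmbeddingLike.apply_eq_iff_eq]
  have h₁ := Equiv.sum_comp (Equiv.addRight c) (fun i => stayProb p x i)
  have h₂ := Equiv.sum_comp (Equiv.addRight c)
    (fun i => if y = flipAt x i then (N : ℝ)⁻¹ * flipProb p x i else 0)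
  simp only [Equiv.coe_addRight] at h₁ h₂
  refine if_congr Iff.rfl (congrArg _ h₁) ?_
  exact (Finset.sum_congr rfl fun i _ => if_congr Iff.rfl rfl rfl).trans h₂

theorem IsErgodicWith.rotate_eq {p : Fin 4 → ℝ} {π : Config N → ℝ}
    (h : IsErgodicWith (transition p) π) (c : ZMod N) (x : Config N) :
    π (rotate c x) = π x := by
  refine congrFun (h.unique (fun x => π (rotate c x)) ⟨⟨fun x => h.stationary.1.1 _, ?_⟩, ?_⟩) x
  · rw [Equiv.sum_comp (rotate c) π]
    exact h.stationary.1.2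
  · funext y
    have hy := congrFun h.stationary.2 (rotate c y)
    change ∑ x, π (rotate c x) * transition p x y = π (rotate c y)
    change ∑ x, π x * transition p x (rotate c y) = _ at hy
    rw [← hy, ← Equiv.sum_comp (rotate c) fun x => π x * transition p x (rotate c y)]
    simp only [transition_rotate]

theorem IsErgodicWith.sum_rotate {p : Fin 4 → ℝ} {π : Config N → ℝ}
    (h : IsErgodicWith (transition p) π) (c : ZMod N) (f : Config N → ℝ) :
    ∑ x, π x * f (rotate c x) = ∑ x, π x * f x := by
  rw [← Equiv.sum_comp (rotate c) fun x => π x * f x]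
  simp only [h.rotate_eq]

theorem marginal₁_eq_sum (π : Config N → ℝ) (i : ZMod N) (u : Fin 2) :
    marginal₁ π i u = ∑ x, π x * if x i = u then 1 else 0 := by
  simp [marginal₁, Finset.sum_filter]

theorem marginal₂_eq_sum (π : Config N → ℝ) (i j : ZMod N) (u v : Fin 2) :
    marginal₂ π i j u v = ∑ x, π x * if x i = u ∧ x j = v then 1 else 0 := by
  simp [marginal₂, Finset.sum_filter]

theorem IsErgodicWith.marginal₁_eq {p : Fin 4 → ℝ} {π : Config N → ℝ}
    (h : IsErgodicWith (transition p) π) (i j : ZMod N) (u : Fin 2) :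
    marginal₁ π i u = marginal₁ π j u := by
  rw [marginal₁_eq_sum, marginal₁_eq_sum, ← h.sum_rotate (i - j) fun x => if x j = u then 1 else 0]
  simp only [rotate_apply, add_sub_cancel]

theorem IsErgodicWith.marginal₂_eq {p : Fin 4 → ℝ} {π : Config N → ℝ}
    (h : IsErgodicWith (transition p) π) (i j k : ZMod N) (u v : Fin 2) :
    marginal₂ π i (i + k) u v = marginal₂ π j (j + k) u v := by
  rw [marginal₂_eq_sum, marginal₂_eq_sum,
    ← h.sum_rotate (i - j) fun x => if x j = u ∧ x (j + k) = v then 1 else 0]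
  have e : j + k + (i - j) = i + k := by ring
  simp only [rotate_apply, add_sub_cancel, e]

theorem sum_mul_nbr (π : Config N → ℝ) (g : Fin 4 → ℝ) (i : ZMod N) :
    ∑ x, π x * g (nbr x i) =
      ∑ u : Fin 2, ∑ v : Fin 2, marginal₂ π (i - 1) (i + 1) u v * g (code u v) := by
  have e : ∀ x : Config N, π x * g (nbr x i) = ∑ u : Fin 2, ∑ v : Fin 2,
      (π x * if x (i - 1) = u ∧ x (i + 1) = v then 1 else 0) * g (code u v) := fun x => by
    simp [ite_and, nbr]
  simp only [e, marginal₂_eq_sum, Finset.sum_mul]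
  rw [Finset.sum_comm]
  refine Finset.sum_congr rfl fun u _ => Finset.sum_comm

/-- In equilibrium the player's winning probability equals the probability of being a winner. -/
theorem IsErgodicWith.sum_mul_p_nbr {p : Fin 4 → ℝ} {π : Config N → ℝ}
    (h : IsErgodicWith (transition p) π) (i : ZMod N) :
    ∑ x, π x * p (nbr x i) = marginal₁ π i 1 := by
  have hN : (N : ℝ) ≠ 0 := NeZero.ne _
  have hst := h.dotProduct_mulVec fun x => if x i = 1 then 1 else 0
  simp only [dotProduct, Matrix.mulVec, sum_transition_mul] at hst
  have e : ∀ x : Config N, (N : ℝ)⁻¹ * ∑ j, (flipProb p x j *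
      (if flipAt x j i = 1 then 1 else 0) + stayProb p x j * (if x i = 1 then 1 else 0)) =
      (if x i = 1 then 1 else 0) + (N : ℝ)⁻¹ * (p (nbr x i) - if x i = 1 then 1 else 0) := by
    intro x
    have e' : ∀ j, flipProb p x j * (if flipAt x j i = 1 then 1 else 0) +
        stayProb p x j * (if x i = 1 then (1 : ℝ) else 0) = (if x i = 1 then 1 else 0) +
        if i = j then p (nbr x i) - (if x i = 1 then 1 else 0) else 0 := by
      intro j
      have hfs := flipProb_add_stayProb p x j
      by_cases hij : i = j
      · subst hij
        rcases Fin.exists_fin_two.1 ⟨x i, rfl⟩ with hx | hx <;>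
          simp [flipAt, flipProb, stayProb, hx]
      · rw [flipAt, Function.update_of_ne hij, ← add_mul, hfs, one_mul, if_neg hij, add_zero]
    simp only [e']
    rw [Finset.sum_add_distrib, mul_add, natCast_inv_mul_sum_const, Finset.sum_ite_eq,
      if_pos (Finset.mem_univ _)]
  simp only [e] at hst
  simp only [mul_add, mul_sub, Finset.sum_add_distrib, Finset.sum_sub_distrib] at hst
  simp only [mul_left_comm _ ((N : ℝ)⁻¹), ← Finset.mul_sum] at hst
  rw [← marginal₁_eq_sum] at hst
  have h₁ : (N : ℝ)⁻¹ * ((∑ x, π x * p (nbr x i)) - marginal₁ π i 1) = 0 := by linarith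
  rcases mul_eq_zero.1 h₁ with h₁ | h₁
  · exact absurd h₁ (inv_ne_zero hN)
  · linarith

end Game

end Parrondo

open Parrondo in
theorem mainTheorem5 (N : ℕ) [NeZero N] (hN : 3 ≤ N) (p : Fin 4 → ℝ)
    (hp : ∀ m, p m ∈ Set.Icc (0 : ℝ) 1) (π : Config N → ℝ)
    (herg : IsErgodicWith (transition p) π) :
    ∃ μN : ℝ,
      -- strong law of large numbers, for every initial distribution
      (∀ (Ω : Type*) [MeasurableSpace Ω] (ℙ : Measure Ω) [IsProbabilityMeasure ℙ]
        (Z : ℕ → Ω → AugState N), IsMarkovChain (augTransition p) ℙ Z →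
          ∀ᵐ ω ∂ℙ, Tendsto (fun n : ℕ => (n : ℝ)⁻¹ * profit Z n ω) atTop (𝓝 μN)) ∧
      -- in terms of the stationary distribution
      μN = (N : ℝ)⁻¹ * ∑ x : Config N, π x *
        ∑ i : ZMod N, (p (nbr x i) - (1 - p (nbr x i))) ∧
      -- in terms of the two-dimensional marginals
      (∀ (i : ZMod N) (u v : Fin 2), marginal₂ π i (i + 2) u v = marginal₂ π 1 3 u v) ∧
      μN = ∑ u : Fin 2, ∑ v : Fin 2, marginal₂ π 1 3 u v * (p (code u v) - (1 - p (code u v))) ∧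
      μN = 2 * (marginal₂ π 1 3 0 0 * p 0 + marginal₂ π 1 3 0 1 * p 1 +
        marginal₂ π 1 3 1 0 * p 2 + marginal₂ π 1 3 1 1 * p 3) - 1 ∧
      -- in terms of the one-dimensional marginals
      (∀ (i : ZMod N) (u : Fin 2), marginal₁ π i u = marginal₁ π 1 u) ∧
      μN = marginal₁ π 1 1 - marginal₁ π 1 0 ∧
      μN = 2 * marginal₁ π 1 1 - 1 := by
  set g : Fin 4 → ℝ := fun m => p m - (1 - p m) with hg
  have htot : ∑ x, π x = 1 := herg.stationary.1.2
  have h13 : ∀ (i : ZMod N) (u v : Fin 2),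
      marginal₂ π i (i + 2) u v = marginal₂ π 1 3 u v := fun i u v => by
    have h3 : (3 : ZMod N) = 1 + 2 := by norm_num
    rw [h3]
    exact herg.marginal₂_eq i 1 2 u v
  have hnbr : ∀ i : ZMod N, ∑ x, π x * g (nbr x i) =
      ∑ u : Fin 2, ∑ v : Fin 2, marginal₂ π 1 3 u v * g (code u v) := fun i => by
    have e : i + 1 = i - 1 + 2 := by ring
    simp only [sum_mul_nbr, e, h13]
  have hμ : (N : ℝ)⁻¹ * ∑ x : Config N, π x * ∑ i : ZMod N, g (nbr x i) =
      ∑ u : Fin 2, ∑ v : Fin 2, marginal₂ π 1 3 u v * g (code u v) := by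
    have e : ∀ x, π x * ∑ i : ZMod N, g (nbr x i) = ∑ i : ZMod N, π x * g (nbr x i) :=
      fun x => Finset.mul_sum _ _ _
    simp only [e]
    rw [Finset.sum_comm]
    simp only [hnbr, natCast_inv_mul_sum_const]
  have hone : ∑ x, π x * g (nbr x 1) = 2 * marginal₁ π 1 1 - 1 := by
    rw [← herg.sum_mul_p_nbr 1, ← htot, Finset.mul_sum, ← Finset.sum_sub_distrib]
    refine Finset.sum_congr rfl fun x _ => ?_
    simp only [hg]
    ring
  have hm1 : marginal₁ π 1 0 + marginal₁ π 1 1 = 1 := by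
    rw [marginal₁_eq_sum, marginal₁_eq_sum, ← Finset.sum_add_distrib]
    refine (Finset.sum_congr rfl fun x _ => ?_).trans htot
    rcases Fin.exists_fin_two.1 ⟨x 1, rfl⟩ with hx | hx <;> simp [hx]
  have hm2 : marginal₂ π 1 3 0 0 + marginal₂ π 1 3 0 1 + marginal₂ π 1 3 1 0 +
      marginal₂ π 1 3 1 1 = 1 := by
    simp only [marginal₂_eq_sum, ← Finset.sum_add_distrib]
    refine (Finset.sum_congr rfl fun x _ => ?_).trans htot
    rcases Fin.exists_fin_two.1 ⟨x 1, rfl⟩ with hx | hx <;>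
      rcases Fin.exists_fin_two.1 ⟨x 3, rfl⟩ with hy | hy <;> simp [hx, hy]
  refine ⟨(N : ℝ)⁻¹ * ∑ x : Config N, π x * ∑ i : ZMod N, g (nbr x i), ?_, rfl, h13, hμ, ?_,
    fun i u => herg.marginal₁_eq i 1 u, ?_, ?_⟩
  · intro Ω _ ℙ _ Z hZ
    set μ := (N : ℝ)⁻¹ * ∑ x : Config N, π x * ∑ i : ZMod N, g (nbr x i) with hμdef
    obtain ⟨φ, hφ⟩ := herg.exists_poisson
      (f := fun x => (N : ℝ)⁻¹ * ∑ i : ZMod N, (g (nbr x i) - μ)) (by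
        have e : ∀ x, (N : ℝ)⁻¹ * ∑ i : ZMod N, (g (nbr x i) - μ) =
            (N : ℝ)⁻¹ * (∑ i : ZMod N, g (nbr x i)) - μ := fun x => by
          rw [Finset.sum_sub_distrib, mul_sub, natCast_inv_mul_sum_const]
        simp only [dotProduct, e]
        simp only [mul_sub, Finset.sum_sub_distrib, ← Finset.sum_mul, htot]
        simp only [mul_left_comm _ ((N : ℝ)⁻¹), ← Finset.mul_sum]
        rw [one_mul, hμdef, sub_self])
    have hφ' : ∀ x, φ x - ∑ y, transition p x y * φ y =
        (N : ℝ)⁻¹ * ∑ i : ZMod N, (g (nbr x i) - μ) := fun x => congrFun hφ x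
    exact hZ.ae_tendsto_of_poisson (w := payoff) (sum_augTransition p) fun s => by
      rw [sum_augTransition_mul_payoff]
      exact augTransition_poisson (G := fun s => g (nbr s.1 s.2) - μ) hφ' s
  · have c : code 0 0 = 0 ∧ code 0 1 = 1 ∧ code 1 0 = 2 ∧ code 1 1 = 3 := by decide
    rw [hμ]
    simp only [Fin.sum_univ_two, c, hg]
    linarith
  · rw [hμ, ← hnbr 1, hone]
    linarith
  · rw [hμ, ← hnbr 1, hone]
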